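/- Let $G$ be an arbitrary discrete group (no countability assumed) and let $H\le G$ be a subgroup. For a subgroup $K\le G$ let $L(K)$ denote the von Neumann algebra on $\ell^2(G)$ generated by the left translation unitaries $\lambda_k$, $k\in K$, where $(\lambda_k f)(x)=f(k^{-1}x)$; in particular $L(H)\subseteq L(G)$. For an inclusion $B\subseteq M$ of von Neumann algebras, let $q\mathcal N^{(1)}_M(B)$ (the one sided quasi-normalizers) be the set of all $x\in M$ for which there are finitely many $x_1,\dots,x_n\in M$ with $Bx\subseteq\sum_{i=1}^n x_iB$, and let $q\mathcal N_M(B)$ (the quasi-normalizers) be the set of all $x\in M$ for which there are finitely many $x_1,\dots,x_n\in M$ with both $Bx\subseteq\sum_{i=1}^n x_iB$ and $xB\subseteq\sum_{i=1}^n Bx_i$. Let $\Gamma$ be the semigroup of all $g\in G$ for which there is a finite set $\{g_1,\dots,g_n\}\subseteq G$ with $Hg\subseteq\bigcup_{i=1}^n g_iH$. Let $H_1=\Gamma\cap\Gamma^{-1}$, which is a subgroup of $G$, and let $H_2$ be the subgroup of $G$ generated by $\Gamma$. Then (i) $q\mathcal N_{L(G)}(L(H))''=L(H_1)$, where $''$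 denotes the double commutant in $B(\ell^2(G))$; (ii) $W^*\big(q\mathcal N^{(1)}_{L(G)}(L(H))\big)=L(H_2)$, where $W^*(S)$ denotes the von Neumann algebra generated by $S$ (the smallest one containing $S$). -/

import Mathlib

noncomputable section

/-! ### Von Neumann algebras and their quasi-normalizers -/

namespace VonNeumannAlgebra

variable {E : Type*} [NormedAddCommGroup E] [InnerProductSpace ℂ E] [CompleteSpace E]

/-- The von Neumann algebra `W*(S) = (S ∪ S*)''` generated by a set `S` of bounded operators. -/
def generatedBy (S : Set (E →L[ℂ] E)) : VonNeumannAlgebra E where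
  toStarSubalgebra :=
    StarSubalgebra.centralizer ℂ (StarSubalgebra.centralizer ℂ S : Set (E →L[ℂ] E))
  centralizer_centralizer' := by simp

theorem coe_generatedBy (S : Set (E →L[ℂ] E)) :
    (generatedBy S : Set (E →L[ℂ] E)) = Set.centralizer (Set.centralizer (S ∪ star S)) := by
  change ((StarSubalgebra.centralizer ℂ (StarSubalgebra.centralizer ℂ S : Set (E →L[ℂ] E)) :
    StarSubalgebra ℂ (E →L[ℂ] E)) : Set (E →L[ℂ] E)) = _
  exact StarSubalgebra.coe_centralizer_centralizer ℂ S

theorem subset_generatedBy (S : Set (E →L[ℂ] E)) : S ⊆ generatedBy S := by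
  rw [coe_generatedBy]
  exact Set.subset_union_left.trans Set.subset_centralizer_centralizer

/-- `generatedBy S` is the smallest von Neumann algebra containing `S`. -/
theorem generatedBy_le_iff {S : Set (E →L[ℂ] E)} {M : VonNeumannAlgebra E} :
    generatedBy S ≤ M ↔ S ⊆ M := by
  refine ⟨fun h => (subset_generatedBy S).trans h, fun h => ?_⟩
  change (generatedBy S : Set (E →L[ℂ] E)) ⊆ M
  rw [coe_generatedBy, ← M.centralizer_centralizer]
  refine Set.centralizer_subset (Set.centralizer_subset (Set.union_subset h ?_))
  intro x hx
  have := star_mem (h hx)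
  simpa using! this

/-- The one sided quasi-normalizers of `B` in `M`: those `x ∈ M` for which there are
`x₁, …, xₙ ∈ M` with `B x ⊆ ∑ᵢ xᵢ B`. -/
def oneSidedQuasiNormalizers (B M : VonNeumannAlgebra E) : Set (E →L[ℂ] E) :=
  {x | x ∈ M ∧ ∃ (n : ℕ) (y : Fin n → (E →L[ℂ] E)), (∀ i, y i ∈ M) ∧
    ∀ b ∈ B, ∃ c : Fin n → (E →L[ℂ] E), (∀ i, c i ∈ B) ∧ b * x = ∑ i, y i * c i}

/-- The quasi-normalizers of `B` in `M`: those `x ∈ M` for which there are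
`x₁, …, xₙ ∈ M` with `B x ⊆ ∑ᵢ xᵢ B` and `x B ⊆ ∑ᵢ B xᵢ`. -/
def quasiNormalizers (B M : VonNeumannAlgebra E) : Set (E →L[ℂ] E) :=
  {x | x ∈ M ∧ ∃ (n : ℕ) (y : Fin n → (E →L[ℂ] E)), (∀ i, y i ∈ M) ∧
    (∀ b ∈ B, ∃ c : Fin n → (E →L[ℂ] E), (∀ i, c i ∈ B) ∧ b * x = ∑ i, y i * c i) ∧
    (∀ b ∈ B, ∃ c : Fin n → (E →L[ℂ] E), (∀ i, c i ∈ B) ∧ x * b = ∑ i, c i * y i)}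

/-- The one sided quasi-normalizer algebra `W*(qN⁽¹⁾_M(B))`. -/
def oneSidedQuasiNormalizerAlgebra (B M : VonNeumannAlgebra E) : VonNeumannAlgebra E :=
  generatedBy (oneSidedQuasiNormalizers B M)

end VonNeumannAlgebra

/-! ### Group von Neumann algebras -/

/-- The Hilbert space `ℓ²(G)`. -/
abbrev EllTwo (G : Type*) : Type _ := lp (fun _ : G => ℂ) 2

/-- Left translation on `ℓ²(G)`: `(λ_g f)(x) = f (g⁻¹ x)`, a unitary operator that sends the
basis vector at `x` to the basis vector at `g x`. -/
def leftRegular {G : Type*} [Group G] (g : G) : EllTwo G →L[ℂ] EllTwo G :=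
  LinearIsometry.toContinuousLinearMap
    { toFun := fun f => ⟨fun x => f (g⁻¹ * x), by
        refine (memℓp_gen_iff (by simp)).2 ?_
        have h := (memℓp_gen_iff (p := 2) (by simp)).1 (lp.memℓp f)
        exact (Equiv.mulLeft g⁻¹).summable_iff.2 h⟩
      map_add' := fun _ _ => rfl
      map_smul' := fun _ _ => rfl
      norm_map' := fun f => by
        rw [lp.norm_eq_tsum_rpow (by simp), lp.norm_eq_tsum_rpow (by simp)]
        congr 1
        exact (Equiv.mulLeft g⁻¹).tsum_eq (fun x => ‖f x‖ ^ (2 : ENNReal).toReal) }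

@[simp]
theorem leftRegular_apply {G : Type*} [Group G] (g : G) (f : EllTwo G) (x : G) :
    leftRegular g f x = f (g⁻¹ * x) := rfl

/-- For a subgroup `K` of `G`, the group von Neumann algebra `L(K)`, embedded as usual in `L(G)` as
the von Neumann algebra on `ℓ²(G)` generated by the unitaries `λ_k`, `k ∈ K`. In particular
`L(G)` itself is `groupVonNeumannAlgebra ⊤`. -/
def groupVonNeumannAlgebra {G : Type*} [Group G] (K : Subgroup G) : VonNeumannAlgebra (EllTwo G) :=
  VonNeumannAlgebra.generatedBy (leftRegular '' (K : Set G))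

/-! ### Quasi-normalizers of subgroups -/

namespace Subgroup

variable {G : Type*} [Group G]

/-- The semigroup `Γ` of one sided quasi-normalizers of `H` in `G`: those `g` for which there is a
finite set `{g₁, …, gₙ} ⊆ G` with `H g ⊆ ⋃ᵢ gᵢ H`. -/
def oneSidedQuasiNormalizers (H : Subgroup G) : Submonoid G where
  carrier := {g | ∃ s : Finset G, ∀ h ∈ H, ∃ a ∈ s, ∃ k ∈ H, h * g = a * k}
  one_mem' := ⟨{1}, fun h hh => ⟨1, by simp, h, hh, by simp⟩⟩
  mul_mem' := by
    classical
    rintro g g' ⟨s, hs⟩ ⟨t, ht⟩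
    refine ⟨Finset.image₂ (· * ·) s t, fun h hh => ?_⟩
    obtain ⟨a, ha, k, hk, e⟩ := hs h hh
    obtain ⟨b, hb, l, hl, e'⟩ := ht k hk
    refine ⟨a * b, Finset.mem_image₂_of_mem ha hb, l, hl, ?_⟩
    rw [← mul_assoc, e, mul_assoc, e', mul_assoc]

/-- The subgroup `H₁ = Γ ∩ Γ⁻¹`. -/
def quasiNormalizerSubgroup (H : Subgroup G) : Subgroup G where
  carrier := {g | g ∈ H.oneSidedQuasiNormalizers ∧ g⁻¹ ∈ H.oneSidedQuasiNormalizers}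
  one_mem' := by simp
  mul_mem' := by
    rintro a b ⟨ha, ha'⟩ ⟨hb, hb'⟩
    exact ⟨mul_mem ha hb, by rw [mul_inv_rev]; exact mul_mem hb' ha'⟩
  inv_mem' := by
    rintro a ⟨ha, ha'⟩
    exact ⟨ha', by rwa [inv_inv]⟩

/-- The subgroup `H₂` of `G` generated by `Γ`. -/
def oneSidedQuasiNormalizerSubgroup (H : Subgroup G) : Subgroup G :=
  Subgroup.closure (H.oneSidedQuasiNormalizers : Set G)

end Subgroup

end

/-! An element `x` of L(G) is determined by its Fourier coefficients `x (delta 1) g`, and it lies in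
L(K) exactly when they vanish off K. So both equalities reduce to two facts: λ_g is a one sided
quasi-normalizer for g ∈ Γ, and every one sided quasi-normalizer has its Fourier support in Γ. The
two sided case follows by taking adjoints.

For g ∈ Γ and b ∈ L(H), the coefficients of b λ_g live on finitely many cosets qH. Each piece, cut
to one coset, must be shown to be a bounded operator (`exists_mul_leftRegular_eq_sum`).

Conversely, let L(H)x ⊆ ∑ yᵢ L(H) and let x have coefficient of modulus α > 0 at g. The vectors λ_h
x δ₁, h ∈ H, have the same norm, have a coefficient of modulus α at hg, and lie in ∑ yᵢ ℓ²(H). This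
right H-invariant space has dimension at most n over H: the diagonal entries of its projection,
summed over coset representatives, are at most n. Hence HgH contains only finitely many left cosets
of H. `card_mul_sq_le` makes this quantitative, replacing the projection by an approximant CDC. No
step needs G countable. -/

open scoped InnerProductSpace

/-! ### Matrix coefficients and coordinate projections on ℓ²(G). -/

namespace EllTwo

variable {G : Type*}

open Classical in
/-- The basis vector of `ℓ²(G)` at `s`. -/
noncomputable def delta (s : G) : EllTwo G := lp.single 2 s (1 : ℂ)

theorem delta_apply_self (s : G) : delta s s = 1 := by
  simp [delta]

theorem delta_apply_ne {s t : G} (h : t ≠ s) : delta s t = 0 := by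
  simp [delta, h]

theorem norm_delta (s : G) : ‖delta s‖ = 1 := by
  simp [delta, lp.norm_single]

theorem inner_delta_left (s : G) (f : EllTwo G) : ⟪delta s, f⟫_ℂ = f s := by
  simp [delta, lp.inner_single_left]

theorem norm_apply_le (f : EllTwo G) (s : G) : ‖f s‖ ≤ ‖f‖ :=
  lp.norm_apply_le_norm (by simp) f s

theorem hasSum_smul_delta (f : EllTwo G) : HasSum (fun s => f s • delta s) f := by
  classical
  have h := lp.hasSum_single (p := 2) (by simp) f
  refine h.congr_fun ?_
  intro s
  rw [delta, ← lp.single_smul]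
  simp

theorem hasSum_apply (x : EllTwo G →L[ℂ] EllTwo G) (f : EllTwo G) (t : G) :
    HasSum (fun s => f s * x (delta s) t) (x f t) := by
  have h := ((hasSum_smul_delta f).mapL x).mapL (innerSL ℂ (delta t))
  simpa [inner_delta_left] using h

theorem ext_delta {x y : EllTwo G →L[ℂ] EllTwo G} (h : ∀ s t, x (delta s) t = y (delta s) t) :
    x = y := by
  refine ContinuousLinearMap.ext fun f => lp.ext (funext fun t => ?_)
  exact (hasSum_apply x f t).unique (by simpa only [h] using hasSum_apply y f t)

theorem adjoint_delta_apply (x : EllTwo G →L[ℂ] EllTwo G) (s t : G) :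
    (star x) (delta s) t = starRingEnd ℂ (x (delta t) s) := by
  rw [← inner_delta_left, ContinuousLinearMap.star_eq_adjoint,
    ContinuousLinearMap.adjoint_inner_right, ← inner_delta_left, inner_conj_symm]

theorem summable_norm_sq (f : EllTwo G) : Summable fun s => ‖f s‖ ^ 2 := by
  simpa using (memℓp_gen_iff (p := 2) (by simp)).1 (lp.memℓp f)

theorem norm_sq_eq_tsum (f : EllTwo G) : ‖f‖ ^ 2 = ∑' s, ‖f s‖ ^ 2 := by
  simpa using lp.norm_rpow_eq_tsum (p := 2) (by simp) f

/-- The projection of `ℓ²(G)` onto the functions supported on `A`. -/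
noncomputable def restrict (A : Set G) : EllTwo G →L[ℂ] EllTwo G :=
  LinearMap.mkContinuous
    { toFun := fun f => ⟨A.indicator f, by
        refine (memℓp_gen_iff (by simp)).2 ?_
        refine Summable.of_nonneg_of_le (fun _ => by positivity) (fun s => ?_)
          ((memℓp_gen_iff (p := 2) (by simp)).1 (lp.memℓp f))
        gcongr
        exact norm_indicator_le_norm_self _ _⟩
      map_add' := fun f g => lp.ext (Set.indicator_add A f g)
      map_smul' := fun c f => lp.ext (Set.indicator_const_smul A c f) } 1 (fun f => by
        refine le_of_sq_le_sq ?_ (by positivity)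
        rw [one_mul, norm_sq_eq_tsum, norm_sq_eq_tsum]
        refine Summable.tsum_le_tsum (fun s => ?_) (summable_norm_sq _) (summable_norm_sq _)
        gcongr
        exact norm_indicator_le_norm_self _ _)

theorem coe_restrict (A : Set G) (f : EllTwo G) : ⇑(restrict A f) = A.indicator f := rfl

theorem restrict_delta_of_mem {A : Set G} {s : G} (h : s ∈ A) :
    restrict A (delta s) = delta s := by
  refine lp.ext ?_
  rw [coe_restrict]
  refine Set.indicator_eq_self.2 fun t ht => ?_
  by_contra hA
  exact ht (delta_apply_ne (by rintro rfl; exact hA h))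

theorem restrict_delta_of_notMem {A : Set G} {s : G} (h : s ∉ A) :
    restrict A (delta s) = 0 := by
  refine lp.ext ?_
  rw [coe_restrict]
  refine Set.indicator_eq_zero.2 (Set.disjoint_left.2 fun t ht hA => ht ?_)
  exact delta_apply_ne (by rintro rfl; exact h hA)

theorem star_restrict (A : Set G) : star (restrict A) = restrict A := by
  refine ext_delta fun s t => ?_
  rw [adjoint_delta_apply, coe_restrict, coe_restrict]
  by_cases h : s = t
  · subst h
    by_cases hs : s ∈ A <;> simp [hs, delta_apply_self]
  · by_cases hs : s ∈ A <;> by_cases ht : t ∈ A <;>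
      simp [hs, ht, delta_apply_ne h, delta_apply_ne (Ne.symm h)]

end EllTwo

/-! ### Fourier coefficients and membership in L(K). -/

section RegularRepresentation

open EllTwo

variable {G : Type*} [Group G]

theorem leftRegular_delta (g s : G) : leftRegular g (delta s) = delta (g * s) := by
  refine lp.ext (funext fun t => ?_)
  rw [leftRegular_apply]
  by_cases h : t = g * s
  · subst h
    simp [delta_apply_self]
  · rw [delta_apply_ne h, delta_apply_ne (fun e => h (by simp [← e]))]

theorem leftRegular_mul (g h : G) :
    leftRegular g * leftRegular h = leftRegular (g * h) :=
  ext_delta fun s t => by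
    rw [mul_apply_eq_comp]
    simp only [leftRegular_delta, mul_assoc]

theorem leftRegular_one : leftRegular (1 : G) = 1 :=
  ext_delta fun s t => by simp

theorem star_leftRegular (g : G) : star (leftRegular g) = leftRegular g⁻¹ :=
  ext_delta fun s t => by
    rw [adjoint_delta_apply, leftRegular_delta, leftRegular_delta]
    by_cases h : s = g * t
    · subst h
      simp [delta_apply_self]
    · rw [delta_apply_ne h, delta_apply_ne (fun e => h (by simp [e])), map_zero]

theorem norm_leftRegular_apply (g : G) (f : EllTwo G) : ‖leftRegular g f‖ = ‖f‖ :=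
  by rw [leftRegular, LinearIsometry.coe_toContinuousLinearMap, LinearIsometry.norm_map]

/-- Right translation on `ℓ²(G)`: `(ρ_g f)(x) = f (x g)`. -/
noncomputable def rightRegular (g : G) : EllTwo G →L[ℂ] EllTwo G :=
  LinearIsometry.toContinuousLinearMap
    { toFun := fun f => ⟨fun x => f (x * g), by
        refine (memℓp_gen_iff (by simp)).2 ?_
        have h := (memℓp_gen_iff (p := 2) (by simp)).1 (lp.memℓp f)
        exact (Equiv.mulRight g).summable_iff.2 h⟩
      map_add' := fun _ _ => rfl
      map_smul' := fun _ _ => rfl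
      norm_map' := fun f => by
        rw [lp.norm_eq_tsum_rpow (by simp), lp.norm_eq_tsum_rpow (by simp)]
        congr 1
        exact (Equiv.mulRight g).tsum_eq (fun x => ‖f x‖ ^ (2 : ENNReal).toReal) }

theorem rightRegular_apply (g : G) (f : EllTwo G) (x : G) :
    rightRegular g f x = f (x * g) := rfl

theorem rightRegular_delta (g s : G) : rightRegular g (delta s) = delta (s * g⁻¹) := by
  refine lp.ext (funext fun t => ?_)
  rw [rightRegular_apply]
  by_cases h : t = s * g⁻¹
  · subst h
    simp [delta_apply_self]
  · rw [delta_apply_ne h, delta_apply_ne (fun e => h (by simp [← e]))]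

theorem star_leftRegular_image (K : Subgroup G) :
    star (leftRegular '' (K : Set G)) = leftRegular '' (K : Set G) := by
  ext x
  constructor
  · rintro ⟨k, hk, e⟩
    exact ⟨k⁻¹, inv_mem hk, by rw [← star_leftRegular, e, star_star]⟩
  · rintro ⟨k, hk, rfl⟩
    exact ⟨k⁻¹, inv_mem hk, by rw [star_leftRegular]⟩

theorem coe_groupVonNeumannAlgebra (K : Subgroup G) :
    (groupVonNeumannAlgebra K : Set (EllTwo G →L[ℂ] EllTwo G)) =
      Set.centralizer (Set.centralizer (leftRegular '' (K : Set G))) := by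
  rw [groupVonNeumannAlgebra, VonNeumannAlgebra.coe_generatedBy, star_leftRegular_image,
    Set.union_self]

theorem leftRegular_mem {K : Subgroup G} {k : G} (hk : k ∈ K) :
    leftRegular k ∈ groupVonNeumannAlgebra K :=
  VonNeumannAlgebra.subset_generatedBy _ ⟨k, hk, rfl⟩

theorem rightRegular_mem_centralizer (A : Set G) (g : G) :
    rightRegular g ∈ Set.centralizer (leftRegular '' A) := by
  rintro _ ⟨k, -, rfl⟩
  refine ext_delta fun s t => ?_
  simp only [mul_apply_eq_comp, leftRegular_delta, rightRegular_delta, mul_assoc]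

theorem restrict_mem_centralizer (K : Subgroup G) :
    restrict (K : Set G) ∈ Set.centralizer (leftRegular '' (K : Set G)) := by
  rintro _ ⟨k, hk, rfl⟩
  refine ext_delta fun s t => ?_
  simp only [mul_apply_eq_comp, leftRegular_delta]
  by_cases hs : s ∈ K
  · rw [restrict_delta_of_mem hs, restrict_delta_of_mem (mul_mem hk hs), leftRegular_delta]
  · rw [restrict_delta_of_notMem hs, restrict_delta_of_notMem, map_zero]
    exact fun h => hs ((K.mul_mem_cancel_left hk).1 h)

/-- The elements of `L(K)` commute with right translations. -/
theorem mul_rightRegular_eq {K : Subgroup G} {x : EllTwo G →L[ℂ] EllTwo G}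
    (hx : x ∈ groupVonNeumannAlgebra K) (g : G) :
    x * rightRegular g = rightRegular g * x := by
  have hx' : x ∈ (groupVonNeumannAlgebra K : Set (EllTwo G →L[ℂ] EllTwo G)) := hx
  rw [coe_groupVonNeumannAlgebra] at hx'
  exact (hx' _ (rightRegular_mem_centralizer _ g)).symm

/-- The matrix coefficients of an element of `L(K)` are determined by its Fourier coefficients. -/
theorem apply_delta_apply {K : Subgroup G} {x : EllTwo G →L[ℂ] EllTwo G}
    (hx : x ∈ groupVonNeumannAlgebra K) (s t : G) :
    x (delta s) t = x (delta 1) (t * s⁻¹) := by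
  have h : (x * rightRegular s⁻¹) (delta 1) = (rightRegular s⁻¹ * x) (delta 1) := by
    rw [mul_rightRegular_eq hx]
  simp only [mul_apply_eq_comp, rightRegular_delta, inv_inv, one_mul] at h
  rw [h, rightRegular_apply]

/-- The projection onto ℓ²(K) commutes with every λ_k, k ∈ K, hence with `x`, and it fixes δ₁. -/
theorem apply_delta_one_eq_zero {K : Subgroup G} {x : EllTwo G →L[ℂ] EllTwo G}
    (hx : x ∈ groupVonNeumannAlgebra K) {g : G} (hg : g ∉ K) : x (delta 1) g = 0 := by
  have hx' : x ∈ (groupVonNeumannAlgebra K : Set (EllTwo G →L[ℂ] EllTwo G)) := hx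
  rw [coe_groupVonNeumannAlgebra] at hx'
  have h : (restrict (K : Set G) * x) (delta 1) = (x * restrict (K : Set G)) (delta 1) := by
    rw [hx' _ (restrict_mem_centralizer K)]
  simp only [mul_apply_eq_comp] at h
  rw [restrict_delta_of_mem (one_mem K)] at h
  rw [← h, coe_restrict, Set.indicator_of_notMem (by exact hg)]

/-- An operator whose matrix coefficients at `(t, s)` depend only on `t s⁻¹` and vanish for
`t s⁻¹ ∉ K` lies in `L(K)`. -/
theorem mem_groupVonNeumannAlgebra_of_apply_delta {K : Subgroup G}
    {x : EllTwo G →L[ℂ] EllTwo G} (φ : G → ℂ) (hφ : ∀ s t, x (delta s) t = φ (t * s⁻¹))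
    (hK : ∀ g, g ∉ K → φ g = 0) : x ∈ groupVonNeumannAlgebra K := by
  change x ∈ (groupVonNeumannAlgebra K : Set (EllTwo G →L[ℂ] EllTwo G))
  rw [coe_groupVonNeumannAlgebra]
  intro T hT
  refine ext_delta fun s t => ?_
  rw [mul_apply_eq_comp, mul_apply_eq_comp]
  have h1 := hasSum_apply T (x (delta s)) t
  have h2 := hasSum_apply x (T (delta s)) t
  -- The substitution v = t u⁻¹ s matches the series for T x and x T term by term: for k = t u⁻¹ ∈
  -- K, commutation of T with λ_k gives (T δ_{ks})(t) = (T δ_s)(u).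
  let e : G ≃ G := (Equiv.inv G).trans ((Equiv.mulLeft t).trans (Equiv.mulRight s))
  rw [← e.hasSum_iff] at h1
  refine h1.unique (h2.congr_fun fun u => ?_)
  have he : e u = t * u⁻¹ * s := rfl
  simp only [Function.comp_apply, he, hφ, mul_inv_cancel_right]
  by_cases hk : t * u⁻¹ ∈ K
  · have hc : (leftRegular (t * u⁻¹) * T) (delta s) = (T * leftRegular (t * u⁻¹)) (delta s) := by
      rw [hT _ ⟨_, hk, rfl⟩]
    rw [mul_apply_eq_comp, mul_apply_eq_comp, leftRegular_delta] at hc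
    rw [← hc, leftRegular_apply, mul_comm]
    simp
  · rw [hK _ hk, zero_mul, mul_zero]

theorem mem_groupVonNeumannAlgebra_of_forall_notMem {K L : Subgroup G}
    {x : EllTwo G →L[ℂ] EllTwo G} (hx : x ∈ groupVonNeumannAlgebra L)
    (hK : ∀ g, g ∉ K → x (delta 1) g = 0) : x ∈ groupVonNeumannAlgebra K :=
  mem_groupVonNeumannAlgebra_of_apply_delta _ (apply_delta_apply hx) hK

end RegularRepresentation

/-! ### Group elements as quasi-normalizers of L(H). -/

section QuasiNormalizers

open EllTwo

variable {G : Type*} [Group G]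

/-- A map `G → H` that is equivariant for left translations by `H`. -/
theorem Subgroup.exists_leftEquivariant (H : Subgroup G) :
    ∃ ρ : G → G, (∀ s, ρ s ∈ H) ∧ ∀ h ∈ H, ∀ s, ρ (h * s) = h * ρ s := by
  -- The representative of s⁻¹H is s⁻¹k with k ∈ H, so the product is k; replacing s by hs leaves
  -- the coset s⁻¹H unchanged.
  refine ⟨fun s => s * ((s⁻¹ : G) : G ⧸ H).out, fun s => ?_, fun h hh s => ?_⟩
  · obtain ⟨k, hk⟩ := QuotientGroup.mk_out_eq_mul H s⁻¹
    simp [hk]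
  · have : (((h * s)⁻¹ : G) : G ⧸ H) = ((s⁻¹ : G) : G ⧸ H) := by
      rw [QuotientGroup.eq]
      simpa using hh
    simp only [this, mul_assoc]

/-- If the finite set `Q ⊆ G ⧸ H` contains all cosets in `H g H`, then
`b λ_g ∈ ∑_{q ∈ Q} λ_q L(H)` for all `b ∈ L(H)`. -/
theorem exists_mul_leftRegular_eq_sum {H : Subgroup G} {g : G} {Q : Finset (G ⧸ H)}
    (hQ : ∀ h ∈ H, ((h * g : G) : G ⧸ H) ∈ Q) {b : EllTwo G →L[ℂ] EllTwo G}
    (hb : b ∈ groupVonNeumannAlgebra H) :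
    ∃ c : G ⧸ H → (EllTwo G →L[ℂ] EllTwo G), (∀ q, c q ∈ groupVonNeumannAlgebra H) ∧
      b * leftRegular g = ∑ q ∈ Q, leftRegular q.out * c q := by
  classical
  obtain ⟨ρ, hρ, hρ'⟩ := H.exists_leftEquivariant
  set φ : G → ℂ := fun u => b (delta 1) (u * g⁻¹) with hφ
  have hx : ∀ s t, (b * leftRegular g) (delta s) t = φ (t * s⁻¹) := fun s t => by
    rw [mul_apply_eq_comp, leftRegular_delta, apply_delta_apply hb, mul_inv_rev, ← mul_assoc]
  -- Cutting b λ_g to the coset q' imposes t s⁻¹ H = q' on the entry (t, s). When t s⁻¹ g⁻¹ ∈ H,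
  -- equivariance of ρ turns this into ρ(t)⁻¹ q' = ρ(gs)⁻¹ gH, a function of t equal to a function
  -- of s. The right side lies in the finite set Q, so the cut is a finite sum of products with
  -- coordinate projections, hence bounded.
  let y : G ⧸ H → (EllTwo G →L[ℂ] EllTwo G) := fun q' => ∑ q ∈ Q,
    restrict {t | (ρ t)⁻¹ • q' = q} * (b * leftRegular g) *
      restrict {s | (ρ (g * s))⁻¹ • ((g : G) : G ⧸ H) = q}
  have hy : ∀ q s t, y q (delta s) t =
      if ((t * s⁻¹ : G) : G ⧸ H) = q then φ (t * s⁻¹) else 0 := fun q' s t => by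
    simp only [y, sum_apply, lp.coeFn_sum, Finset.sum_apply]
    rw [Finset.sum_eq_single ((ρ (g * s))⁻¹ • ((g : G) : G ⧸ H))]
    · rw [mul_apply_eq_comp, mul_apply_eq_comp, restrict_delta_of_mem
        (A := {s | (ρ (g * s))⁻¹ • ((g : G) : G ⧸ H) = _}) (s := s) rfl, coe_restrict,
        Set.indicator_apply, hx]
      by_cases hk : t * s⁻¹ * g⁻¹ ∈ H
      · have ht : t = (t * s⁻¹ * g⁻¹) * (g * s) := by group
        have hρt : ρ t = (t * s⁻¹ * g⁻¹) * ρ (g * s) := by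
          rw [← hρ' _ hk, ← ht]
        congr 1
        rw [Set.mem_ofPred_eq, hρt, mul_inv_rev, mul_smul, smul_left_cancel_iff, inv_smul_eq_iff,
          MulAction.Quotient.smul_coe, smul_eq_mul, inv_mul_cancel_right]
        exact propext eq_comm
      · simp [hφ, apply_delta_one_eq_zero hb hk]
    · intro q _ hq
      rw [mul_apply_eq_comp, restrict_delta_of_notMem
        (A := {s | (ρ (g * s))⁻¹ • ((g : G) : G ⧸ H) = _}) (s := s) (fun h => hq (Eq.symm h)),
        map_zero]
      rfl
    · intro h
      exact absurd (hQ _ (inv_mem (hρ (g * s)))) h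
  refine ⟨fun q => leftRegular q.out⁻¹ * y q, fun q => ?_, ?_⟩
  · refine mem_groupVonNeumannAlgebra_of_apply_delta
      (fun u => if ((q.out * u : G) : G ⧸ H) = q then φ (q.out * u) else 0) (fun s t => ?_)
      (fun u hu => if_neg fun h => hu ?_)
    · rw [mul_apply_eq_comp, leftRegular_apply, inv_inv, hy, mul_assoc]
    · rw [← QuotientGroup.out_eq' q, QuotientGroup.eq] at h
      simpa using h
  · simp only [← mul_assoc, leftRegular_mul, mul_inv_cancel, leftRegular_one, one_mul]
    refine ext_delta fun s t => ?_
    simp only [sum_apply, lp.coeFn_sum, Finset.sum_apply, hy, hx,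
      Finset.sum_ite_eq]
    split_ifs with h
    · rfl
    · by_contra hne
      by_cases hk : t * s⁻¹ * g⁻¹ ∈ H
      · exact h (by simpa using hQ _ hk)
      · exact hne (apply_delta_one_eq_zero hb hk)

theorem exists_fin_mul_leftRegular_eq_sum {H : Subgroup G} {g : G}
    (hg : g ∈ H.oneSidedQuasiNormalizers) :
    ∃ (n : ℕ) (a : Fin n → G), ∀ b ∈ groupVonNeumannAlgebra H,
      ∃ c : Fin n → (EllTwo G →L[ℂ] EllTwo G), (∀ i, c i ∈ groupVonNeumannAlgebra H) ∧
        b * leftRegular g = ∑ i, leftRegular (a i) * c i := by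
  classical
  obtain ⟨s, hs⟩ := hg
  let Q : Finset (G ⧸ H) := s.image (fun a : G => (a : G ⧸ H))
  have hQ : ∀ h ∈ H, ((h * g : G) : G ⧸ H) ∈ Q := fun h hh => by
    obtain ⟨a, ha, k, hk, e⟩ := hs h hh
    refine Finset.mem_image.2 ⟨a, ha, ?_⟩
    rw [e]
    simpa [QuotientGroup.eq] using hk
  refine ⟨Q.card, fun i => (Q.equivFin.symm i : G ⧸ H).out, fun b hb => ?_⟩
  obtain ⟨c, hc, e⟩ := exists_mul_leftRegular_eq_sum hQ hb
  refine ⟨fun i => c (Q.equivFin.symm i), fun i => hc _, ?_⟩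
  rw [e, ← Finset.sum_coe_sort]
  exact (Q.equivFin.symm.sum_comp
    (fun q : Q => leftRegular (q : G ⧸ H).out * c (q : G ⧸ H))).symm

theorem leftRegular_mem_oneSidedQuasiNormalizers {H : Subgroup G} {g : G}
    (hg : g ∈ H.oneSidedQuasiNormalizers) :
    leftRegular g ∈ VonNeumannAlgebra.oneSidedQuasiNormalizers (groupVonNeumannAlgebra H)
      (groupVonNeumannAlgebra ⊤) := by
  obtain ⟨n, a, h⟩ := exists_fin_mul_leftRegular_eq_sum hg
  exact ⟨leftRegular_mem (Subgroup.mem_top _), n, fun i => leftRegular (a i),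
    fun i => leftRegular_mem (Subgroup.mem_top _), h⟩

/-- The second inclusion for λ_g is the adjoint of the first for λ_{g⁻¹}. One family must serve
both, so the two lists are concatenated and padded with zero coefficients. -/
theorem leftRegular_mem_quasiNormalizers {H : Subgroup G} {g : G}
    (hg : g ∈ H.quasiNormalizerSubgroup) :
    leftRegular g ∈ VonNeumannAlgebra.quasiNormalizers (groupVonNeumannAlgebra H)
      (groupVonNeumannAlgebra ⊤) := by
  obtain ⟨n, a, h⟩ := exists_fin_mul_leftRegular_eq_sum hg.1
  obtain ⟨m, a', h'⟩ := exists_fin_mul_leftRegular_eq_sum hg.2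
  refine ⟨leftRegular_mem (Subgroup.mem_top _), n + m,
    Fin.append (fun i => leftRegular (a i)) (fun i => leftRegular (a' i)⁻¹),
    fun i => ?_, fun b hb => ?_, fun b hb => ?_⟩
  · refine Fin.addCases (fun i => ?_) (fun i => ?_) i
    · rw [Fin.append_left]
      exact leftRegular_mem (Subgroup.mem_top _)
    · rw [Fin.append_right]
      exact leftRegular_mem (Subgroup.mem_top _)
  · obtain ⟨c, hc, e⟩ := h b hb
    refine ⟨Fin.append c (fun _ => 0), fun i => ?_, by simp [Fin.sum_univ_add, e]⟩
    refine Fin.addCases (fun i => ?_) (fun i => ?_) i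
    · rw [Fin.append_left]
      exact hc i
    · rw [Fin.append_right]
      exact zero_mem _
  · obtain ⟨c, hc, e⟩ := h' (star b) (star_mem hb)
    refine ⟨Fin.append (fun _ => 0) (fun i => star (c i)), fun i => ?_, ?_⟩
    · refine Fin.addCases (fun i => ?_) (fun i => ?_) i
      · rw [Fin.append_left]
        exact zero_mem _
      · rw [Fin.append_right]
        exact star_mem (hc i)
    · have e' := congrArg star e
      rw [star_mul, star_star, star_leftRegular, inv_inv, star_sum] at e'
      simp [Fin.sum_univ_add, e', star_leftRegular]

end QuasiNormalizers

/-! ### Approximate range projections in a C*-algebra. -/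

section CStarAlgebra

variable {A : Type*} [CStarAlgebra A] [PartialOrder A] [StarOrderedRing A]

/-- For positive `D` there is `C = (D + ε)^{-1/2}`. -/
theorem exists_isSelfAdjoint_mul_mul_le_one {D : A} (hD : 0 ≤ D) {ε : ℝ} (hε : 0 < ε) :
    ∃ C : A, IsSelfAdjoint C ∧ C * D * C ≤ 1 ∧
      (1 - C * D * C) * D * (1 - C * D * C) ≤ algebraMap ℝ A ε ∧
      ∀ b, Commute D b → Commute C b := by
  have hsa : IsSelfAdjoint D := hD.isSelfAdjoint
  have hpos : ∀ t ∈ spectrum ℝ D, 0 ≤ t := fun t ht => spectrum_nonneg_of_nonneg hD ht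
  let f : ℝ → ℝ := fun t => (√(t + ε))⁻¹
  have hf : ContinuousOn f (spectrum ℝ D) := by
    refine ContinuousOn.inv₀ (by fun_prop) fun t ht => ?_
    have := hpos t ht
    positivity
  have hf2 : ∀ t ∈ spectrum ℝ D, f t * t * f t = t / (t + ε) := fun t ht => by
    have h0 : 0 < t + ε := by linarith [hpos t ht]
    have h1 : f t * f t = (t + ε)⁻¹ := by
      rw [← mul_inv, Real.mul_self_sqrt h0.le]
    rw [mul_right_comm, h1]
    field_simp
  have hR : cfc f D * D * cfc f D = cfc (fun t => f t * t * f t) D := by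
    rw [cfc_mul (fun t => f t * t) f D, cfc_mul f (fun t => t) D, cfc_id' ℝ D]
  have hg : ContinuousOn (fun t => f t * t * f t) (spectrum ℝ D) := by fun_prop
  refine ⟨cfc f D, cfc_predicate f D, ?_, ?_, fun b hb => hb.cfc_real f⟩
  · rw [hR]
    refine cfc_le_one _ _ fun t ht => ?_
    have := hpos t ht
    rw [hf2 t ht, div_le_one (by positivity)]
    linarith
  · have h1 : 1 - cfc f D * D * cfc f D = cfc (fun t => 1 - f t * t * f t) D := by
      rw [hR, cfc_sub (fun _ => 1) (fun t => f t * t * f t) D, cfc_const_one ℝ D]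
    have h2 : (1 - cfc f D * D * cfc f D) * D * (1 - cfc f D * D * cfc f D) =
        cfc (fun t => (1 - f t * t * f t) * t * (1 - f t * t * f t)) D := by
      rw [cfc_mul (fun t => (1 - f t * t * f t) * t) (fun t => 1 - f t * t * f t) D,
        cfc_mul (fun t => 1 - f t * t * f t) (fun t => t) D, cfc_id' ℝ D, h1]
    rw [h2]
    -- The function is t ε² / (t + ε)², and t ε² ≤ ε (t + ε)².
    refine cfc_le_algebraMap _ _ _ fun t ht => ?_
    have h0 := hpos t ht
    have h3 : 1 - t / (t + ε) = ε / (t + ε) := by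
      field_simp
      ring
    rw [hf2 t ht, h3, div_mul_eq_mul_div, div_mul_div_comm, div_le_iff₀ (by positivity)]
    nlinarith [mul_nonneg h0 hε.le, mul_nonneg (mul_nonneg h0 h0) hε.le, pow_pos hε 3,
      mul_nonneg (mul_nonneg h0 hε.le) hε.le]

theorem norm_sq_le_of_mul_star_le {a : A} {r : ℝ} (hr : 0 ≤ r)
    (h : a * star a ≤ algebraMap ℝ A r) : ‖a‖ ^ 2 ≤ r := by
  rw [sq, ← CStarRing.norm_self_mul_star]
  exact (CStarAlgebra.norm_le_iff_le_algebraMap _ hr (mul_star_self_nonneg a)).2 h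

/-- With D = ∑ zᵢ zᵢ* and C = (D + ε)^{-1/2}, the sum is CDC, which stands in for the range
projection of D. Conjugating zᵢ zᵢ* ≤ D by C and by 1 - CDC gives the two norm bounds. -/
theorem exists_contraction_approximation {n : ℕ} (z : Fin n → A) {ε : ℝ} (hε : 0 < ε) :
    ∃ C : A, IsSelfAdjoint C ∧ (∀ i, ‖C * z i‖ ≤ 1) ∧
      (∀ i, ‖(1 - ∑ j, (C * z j) * star (C * z j)) * z i‖ ^ 2 ≤ ε) ∧
      ∀ b, Commute (∑ i, z i * star (z i)) b → Commute C b := by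
  set D := ∑ i, z i * star (z i) with hDdef
  have hD : 0 ≤ D := Finset.sum_nonneg fun i _ => mul_star_self_nonneg (z i)
  obtain ⟨C, hC, h1, h2, h3⟩ := exists_isSelfAdjoint_mul_mul_le_one hD hε
  have hzD : ∀ i, z i * star (z i) ≤ D := fun i =>
    Finset.single_le_sum (f := fun i => z i * star (z i))
      (fun i _ => mul_star_self_nonneg (z i)) (Finset.mem_univ i)
  have key : ∀ (T : A), IsSelfAdjoint T → ∀ i, (T * z i) * star (T * z i) ≤ T * D * T :=
    fun T hT i => by
      have := star_right_conjugate_le_conjugate (hzD i) T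
      rw [hT.star_eq] at this
      rwa [star_mul, hT.star_eq, mul_assoc, ← mul_assoc (z i), ← mul_assoc]
  have hR : ∑ j, (C * z j) * star (C * z j) = C * D * C := by
    rw [hDdef, Finset.mul_sum, Finset.sum_mul]
    refine Finset.sum_congr rfl fun j _ => ?_
    rw [star_mul, hC.star_eq]
    simp only [mul_assoc]
  refine ⟨C, hC, fun i => ?_, fun i => ?_, h3⟩
  · have := norm_sq_le_of_mul_star_le zero_le_one (a := C * z i)
      (((key C hC i).trans h1).trans_eq (map_one _).symm)
    exact (sq_le_one_iff₀ (norm_nonneg _)).1 this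
  · rw [hR]
    refine norm_sq_le_of_mul_star_le hε.le ((key _ ?_ i).trans h2)
    refine (IsSelfAdjoint.one A).sub ?_
    have := hD.isSelfAdjoint.conjugate C
    rwa [hC.star_eq] at this

end CStarAlgebra

/-! ### A trace estimate over coset representatives. -/

section Support

open EllTwo

variable {G : Type*} [Group G]

/-- If `w` commutes with right translations by `H`, then the trace of `w P w*` on the span of
representatives of distinct left cosets of `H` is at most `‖w P δ₁‖²`, where `P` is the projection
onto `ℓ²(H)`. -/
theorem sum_norm_star_mul_restrict_delta_le {H : Subgroup G} {w : EllTwo G →L[ℂ] EllTwo G}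
    (hw : ∀ h ∈ H, Commute w (rightRegular h)) {ι : Type*} (F : Finset ι) (u : ι → G)
    (hu : Set.InjOn (fun i => (u i : G ⧸ H)) F) :
    ∑ i ∈ F, ‖star (w * restrict (H : Set G)) (delta (u i))‖ ^ 2 ≤
      ‖(w * restrict (H : Set G)) (delta 1)‖ ^ 2 := by
  have hv : (w * restrict (H : Set G)) (delta 1) = w (delta 1) := by
    rw [mul_apply_eq_comp, restrict_delta_of_mem (one_mem H)]
  set v := w (delta 1)
  have hcoef : ∀ (i : ι) (h : H), ‖(star w) (delta (u i)) h‖ = ‖v (u i * (h : G)⁻¹)‖ :=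
    fun i h => by
      have e : (w * rightRegular (h : G)⁻¹) (delta 1) = (rightRegular (h : G)⁻¹ * w) (delta 1) := by
        rw [(hw _ (inv_mem h.2)).eq]
      rw [mul_apply_eq_comp, mul_apply_eq_comp, rightRegular_delta, inv_inv, one_mul] at e
      rw [adjoint_delta_apply, RCLike.norm_conj, e, rightRegular_apply]
  have hterm : ∀ i, ‖star (w * restrict (H : Set G)) (delta (u i))‖ ^ 2 =
      ∑' h : H, ‖v (u i * (h : G)⁻¹)‖ ^ 2 := fun i => by
    rw [star_mul, star_restrict, mul_apply_eq_comp, norm_sq_eq_tsum, coe_restrict]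
    simp only [← hcoef]
    refine Eq.trans ?_ (tsum_subtype (H : Set G)
      (fun h => ‖(star w) (delta (u i)) h‖ ^ 2)).symm
    refine tsum_congr fun h => ?_
    by_cases hh : h ∈ (H : Set G) <;> simp [hh]
  -- The cosets u i H are disjoint, so the points u i h⁻¹ are distinct and all the terms fit into
  -- ‖v‖².
  let j : F × H → G := fun p => u p.1 * (p.2 : G)⁻¹
  have hj : Function.Injective j := by
    rintro ⟨⟨a, ha⟩, h⟩ ⟨⟨b, hb⟩, k⟩ e
    have e' : u a * (h : G)⁻¹ = u b * (k : G)⁻¹ := e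
    have hab : a = b := hu ha hb (by
      have e2 := congrArg (fun g : G => (g : G ⧸ H)) e'
      simpa [QuotientGroup.mk_mul_of_mem] using e2)
    subst hab
    simpa using e'
  have hs := (summable_norm_sq v).comp_injective hj
  simp only [hterm, hv]
  rw [← Finset.sum_coe_sort, norm_sq_eq_tsum v]
  calc ∑ i : F, ∑' h : H, ‖v (u i * (h : G)⁻¹)‖ ^ 2
      = ∑' p, ((fun g => ‖v g‖ ^ 2) ∘ j) p := by rw [hs.tsum_prod, tsum_fintype]; rfl
    _ ≤ ∑' g, ‖v g‖ ^ 2 :=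
      tsum_comp_le_tsum_of_inj (summable_norm_sq v) (fun _ => by positivity) hj

end Support

/-! ### Fourier support of quasi-normalizers, and the two equalities. -/

section Main

open EllTwo

variable {G : Type*} [Group G]

/-- Quantitative form of finite generation: if the vectors `ξ q` (`q ∈ Q`) all have norm at most
`r`, lie in the right `L(H)`-module generated by `x₁, …, xₙ`, and have a coefficient of modulus
at least `α` at representatives `u q` of distinct left cosets of `H`, then the number of these
cosets is bounded. -/
theorem card_mul_sq_le {H : Subgroup G} {n : ℕ} {y : Fin n → (EllTwo G →L[ℂ] EllTwo G)}
    (hy : ∀ i, y i ∈ groupVonNeumannAlgebra (⊤ : Subgroup G)) {ι : Type*} (Q : Finset ι)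
    (u : ι → G) (hu : Set.InjOn (fun q => (u q : G ⧸ H)) Q) (ξ : ι → EllTwo G)
    (η : ι → Fin n → EllTwo G)
    (hξ : ∀ q ∈ Q, ξ q = ∑ i, (y i * restrict (H : Set G)) (η q i)) {r α : ℝ} (hα : 0 < α)
    (hr : ∀ q ∈ Q, ‖ξ q‖ ≤ r) (hξα : ∀ q ∈ Q, α ≤ ‖ξ q (u q)‖) :
    (Q.card : ℝ) * (α / 2) ^ 2 ≤ r ^ 2 * (n * n) := by
  set P := restrict (H : Set G) with hP
  set K : ℝ := ∑ q ∈ Q, ∑ i, ‖η q i‖ with hK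
  have hK0 : 0 ≤ K := Finset.sum_nonneg fun q _ => Finset.sum_nonneg fun i _ => norm_nonneg _
  -- Chosen so that the error of R on each ξ q is at most δ K ≤ α / 2; the 1 covers K = 0. Thus C
  -- depends on Q, but the final bound does not.
  set δ : ℝ := α / (2 * (K + 1)) with hδ
  have hδ0 : 0 < δ := by positivity
  have hδK : δ * K ≤ α / 2 := by
    rw [hδ, div_mul_eq_mul_div, div_le_iff₀ (by positivity)]
    nlinarith
  obtain ⟨C, hC, hC1, hC2, hC3⟩ :=
    exists_contraction_approximation (fun i => y i * P) (pow_pos hδ0 2)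
  set a : Fin n → (EllTwo G →L[ℂ] EllTwo G) := fun i => C * (y i * P)
  set R : EllTwo G →L[ℂ] EllTwo G := ∑ i, a i * star (a i) with hR
  have hC2' : ∀ i, ‖(1 - R) * (y i * P)‖ ≤ δ := fun i =>
    (sq_le_sq₀ (norm_nonneg _) hδ0.le).1 (hC2 i)
  have hcomm : ∀ h ∈ H, ∀ i, Commute (C * y i) (rightRegular h) := fun h hh i => by
    have h1 : ∀ g i, Commute (y i) (rightRegular g) := fun g i => mul_rightRegular_eq (hy i) g
    have h2 : ∀ g i, Commute (star (y i)) (rightRegular g) := fun g i =>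
      mul_rightRegular_eq (star_mem (hy i)) g
    have h3 : Commute P (rightRegular h) := by
      refine ext_delta fun s t => ?_
      simp only [mul_apply_eq_comp, rightRegular_delta, hP]
      by_cases hs : s ∈ H
      · rw [restrict_delta_of_mem hs, restrict_delta_of_mem (mul_mem hs (inv_mem hh)),
          rightRegular_delta]
      · rw [restrict_delta_of_notMem hs, restrict_delta_of_notMem, map_zero]
        exact fun e => hs ((H.mul_mem_cancel_right (inv_mem hh)).1 e)
    refine Commute.mul_left (hC3 _ (Commute.sum_left _ _ _ fun j _ => ?_)) (h1 h i)
    rw [star_mul, hP, star_restrict]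
    exact ((h1 h j).mul_left h3).mul_left (h3.mul_left (h2 h j))
  have htrace : ∀ i, ∑ q ∈ Q, ‖star (a i) (delta (u q))‖ ^ 2 ≤ 1 := fun i => by
    have h1 := sum_norm_star_mul_restrict_delta_le (fun h hh => hcomm h hh i) Q u hu
    rw [mul_assoc] at h1
    refine h1.trans (pow_le_one₀ (norm_nonneg _) ?_)
    refine ((C * (y i * P)).le_opNorm _).trans ?_
    rw [norm_delta, mul_one]
    exact hC1 i
  -- At least α / 2 of the coefficient comes from R, where ⟨δ_u, R ξ⟩ = ∑ ⟨aᵢ* δ_u, aᵢ* ξ⟩.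
  -- Cauchy–Schwarz over i yields one factor n; `htrace` yields the other.
  have hq : ∀ q ∈ Q, (α / 2) ^ 2 ≤ r ^ 2 * (n * ∑ i, ‖star (a i) (delta (u q))‖ ^ 2) :=
    fun q hqQ => by
      have hr0 : 0 ≤ r := (norm_nonneg _).trans (hr q hqQ)
      have e1 : ‖((1 - R) (ξ q)) (u q)‖ ≤ α / 2 := by
        refine (norm_apply_le _ _).trans (le_trans ?_ hδK)
        rw [hξ q hqQ, map_sum]
        refine (norm_sum_le _ _).trans ?_
        calc ∑ i, ‖(1 - R) ((y i * P) (η q i))‖ ≤ ∑ i, δ * ‖η q i‖ :=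
              Finset.sum_le_sum fun i _ =>
                (((1 - R) * (y i * P)).le_opNorm (η q i)).trans
                  (mul_le_mul_of_nonneg_right (hC2' i) (norm_nonneg _))
          _ = δ * ∑ i, ‖η q i‖ := (Finset.mul_sum _ _ _).symm
          _ ≤ δ * K := by
              refine mul_le_mul_of_nonneg_left ?_ hδ0.le
              exact Finset.single_le_sum (f := fun q => ∑ i, ‖η q i‖)
                (fun q _ => Finset.sum_nonneg fun i _ => norm_nonneg _) hqQ
      have e2 : ‖(R (ξ q)) (u q)‖ ≤ r * ∑ i, ‖star (a i) (delta (u q))‖ := by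
        rw [← inner_delta_left, hR, sum_apply, inner_sum, Finset.mul_sum]
        refine (norm_sum_le _ _).trans (Finset.sum_le_sum fun i _ => ?_)
        rw [mul_apply_eq_comp, ← ContinuousLinearMap.adjoint_inner_left,
          ← ContinuousLinearMap.star_eq_adjoint, mul_comm r]
        refine (norm_inner_le_norm _ _).trans
          (mul_le_mul_of_nonneg_left (le_trans ?_ (hr q hqQ)) (norm_nonneg _))
        refine ((star (a i)).le_opNorm _).trans ?_
        exact mul_le_of_le_one_left (norm_nonneg _) ((norm_star (a i)).trans_le (hC1 i))
      have e3 : ξ q (u q) = ((1 - R) (ξ q)) (u q) + (R (ξ q)) (u q) := by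
        have : ξ q = (1 - R) (ξ q) + R (ξ q) := by simp
        exact congrArg (fun f : EllTwo G => f (u q)) this
      have e4 : α / 2 ≤ r * ∑ i, ‖star (a i) (delta (u q))‖ := by
        have := hξα q hqQ
        rw [e3] at this
        linarith [norm_add_le (((1 - R) (ξ q)) (u q)) ((R (ξ q)) (u q))]
      refine (pow_le_pow_left₀ (by positivity) e4 2).trans ?_
      rw [mul_pow]
      refine mul_le_mul_of_nonneg_left ?_ (sq_nonneg r)
      simpa using sq_sum_le_card_mul_sum_sq (s := Finset.univ)
        (f := fun i => ‖star (a i) (delta (u q))‖)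
  calc (Q.card : ℝ) * (α / 2) ^ 2 = ∑ q ∈ Q, (α / 2) ^ 2 := by
        rw [Finset.sum_const, nsmul_eq_mul]
    _ ≤ ∑ q ∈ Q, r ^ 2 * (n * ∑ i, ‖star (a i) (delta (u q))‖ ^ 2) := Finset.sum_le_sum hq
    _ = r ^ 2 * (n * ∑ i, ∑ q ∈ Q, ‖star (a i) (delta (u q))‖ ^ 2) := by
        rw [← Finset.mul_sum, ← Finset.mul_sum, Finset.sum_comm]
    _ ≤ r ^ 2 * (n * n) := by
        refine mul_le_mul_of_nonneg_left (mul_le_mul_of_nonneg_left ?_ n.cast_nonneg)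
          (sq_nonneg r)
        simpa using Finset.sum_le_sum fun i (_ : i ∈ Finset.univ) => htrace i

theorem mem_oneSidedQuasiNormalizers_of_finite {H : Subgroup G} {g : G}
    (h : ((fun h : G => ((h * g : G) : G ⧸ H)) '' (H : Set G)).Finite) :
    g ∈ H.oneSidedQuasiNormalizers := by
  classical
  refine ⟨h.toFinset.image Quotient.out, fun k hk => ?_⟩
  refine ⟨((k * g : G) : G ⧸ H).out, Finset.mem_image_of_mem _ (h.mem_toFinset.2 ⟨k, hk, rfl⟩),
    ((k * g : G) : G ⧸ H).out⁻¹ * (k * g), ?_, by simp⟩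
  rw [← QuotientGroup.eq, QuotientGroup.out_eq']

/-- The Fourier coefficients of a one sided quasi-normalizer of `L(H)` are supported in the
one sided quasi-normalizers of `H`. -/
theorem mem_oneSidedQuasiNormalizers_of_apply_ne_zero {H : Subgroup G}
    {x : EllTwo G →L[ℂ] EllTwo G}
    (hx : x ∈ VonNeumannAlgebra.oneSidedQuasiNormalizers (groupVonNeumannAlgebra H)
      (groupVonNeumannAlgebra ⊤)) {g : G} (hg : x (delta 1) g ≠ 0) :
    g ∈ H.oneSidedQuasiNormalizers := by
  obtain ⟨-, n, y, hy, hxy⟩ := hx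
  refine mem_oneSidedQuasiNormalizers_of_finite ?_
  by_contra hinf
  set α := ‖x (delta 1) g‖ with hα
  have hα0 : 0 < α := norm_pos_iff.2 hg
  -- N exceeds the bound of `card_mul_sq_le` on the number of cosets.
  obtain ⟨N, hN⟩ := exists_nat_gt (‖x (delta 1)‖ ^ 2 * (n * n) / (α / 2) ^ 2)
  obtain ⟨Q, hQ, hQN⟩ := Set.Infinite.exists_subset_card_eq hinf N
  choose! k hk hkq using fun q (hq : q ∈ Q) => hQ hq
  choose! c hc hcx using fun q (hq : q ∈ Q) =>
    hxy (leftRegular (k q)) (leftRegular_mem (hk q hq))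
  have h := card_mul_sq_le hy Q (fun q => k q * g) (H := H)
    (fun q hq q' hq' e => by
      rw [← hkq q hq, ← hkq q' hq']
      exact e)
    (fun q => leftRegular (k q) (x (delta 1))) (fun q i => c q i (delta 1))
    (fun q hq => by
      rw [← mul_apply_eq_comp, hcx q hq, sum_apply]
      refine Finset.sum_congr rfl fun i _ => ?_
      rw [mul_apply_eq_comp, mul_apply_eq_comp]
      congr 1
      refine lp.ext ?_
      rw [coe_restrict]
      refine (Set.indicator_eq_self.2 fun t ht => ?_).symm
      by_contra htH
      exact ht (apply_delta_one_eq_zero (hc q hq i) htH))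
    hα0 (fun q _ => (norm_leftRegular_apply _ _).le)
    (fun q _ => by rw [leftRegular_apply, inv_mul_cancel_left])
  rw [hQN] at h
  rw [div_lt_iff₀ (by positivity)] at hN
  linarith

theorem star_mem_oneSidedQuasiNormalizers {E : Type*} [NormedAddCommGroup E]
    [InnerProductSpace ℂ E] [CompleteSpace E] {B M : VonNeumannAlgebra E} {x : E →L[ℂ] E}
    (hx : x ∈ VonNeumannAlgebra.quasiNormalizers B M) :
    star x ∈ VonNeumannAlgebra.oneSidedQuasiNormalizers B M := by
  obtain ⟨hxM, n, y, hy, -, hxB⟩ := hx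
  refine ⟨star_mem hxM, n, fun i => star (y i), fun i => star_mem (hy i), fun b hb => ?_⟩
  obtain ⟨c, hc, e⟩ := hxB (star b) (star_mem hb)
  refine ⟨fun i => star (c i), fun i => star_mem (hc i), ?_⟩
  have e' := congrArg star e
  simpa using e'

theorem quasiNormalizers_subset_oneSidedQuasiNormalizers {E : Type*} [NormedAddCommGroup E]
    [InnerProductSpace ℂ E] [CompleteSpace E] (B M : VonNeumannAlgebra E) :
    VonNeumannAlgebra.quasiNormalizers B M ⊆ VonNeumannAlgebra.oneSidedQuasiNormalizers B M :=
  fun _ ⟨hxM, n, y, hy, hBx, _⟩ => ⟨hxM, n, y, hy, hBx⟩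

/-- The coefficient of x* at g⁻¹ is the conjugate of that of x at g, so the support statement for x
and x* puts both g and g⁻¹ in Γ. -/
theorem quasiNormalizers_subset (H : Subgroup G) :
    VonNeumannAlgebra.quasiNormalizers (groupVonNeumannAlgebra H) (groupVonNeumannAlgebra ⊤) ⊆
      groupVonNeumannAlgebra H.quasiNormalizerSubgroup := by
  intro x hx
  refine mem_groupVonNeumannAlgebra_of_forall_notMem hx.1 fun g hg => ?_
  by_contra hne
  refine hg ⟨mem_oneSidedQuasiNormalizers_of_apply_ne_zero
    (quasiNormalizers_subset_oneSidedQuasiNormalizers _ _ hx) hne,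
    mem_oneSidedQuasiNormalizers_of_apply_ne_zero (star_mem_oneSidedQuasiNormalizers hx) ?_⟩
  rw [adjoint_delta_apply, apply_delta_apply hx.1]
  simpa using hne

theorem oneSidedQuasiNormalizers_subset (H : Subgroup G) :
    VonNeumannAlgebra.oneSidedQuasiNormalizers (groupVonNeumannAlgebra H)
        (groupVonNeumannAlgebra ⊤) ⊆
      groupVonNeumannAlgebra H.oneSidedQuasiNormalizerSubgroup := by
  intro x hx
  refine mem_groupVonNeumannAlgebra_of_forall_notMem hx.1 fun g hg => ?_
  by_contra hne
  exact hg (Subgroup.subset_closure (mem_oneSidedQuasiNormalizers_of_apply_ne_zero hx hne))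

theorem groupVonNeumannAlgebra_closure_le {S : Set G} {M : VonNeumannAlgebra (EllTwo G)}
    (hS : ∀ g ∈ S, leftRegular g ∈ M) : groupVonNeumannAlgebra (Subgroup.closure S) ≤ M := by
  refine VonNeumannAlgebra.generatedBy_le_iff.2 ?_
  rintro _ ⟨g, hg, rfl⟩
  change leftRegular g ∈ M
  induction hg using Subgroup.closure_induction with
  | mem g hg => exact hS g hg
  | one => exact leftRegular_one (G := G) ▸ one_mem M
  | mul g h _ _ ihg ihh => exact leftRegular_mul g h ▸ mul_mem ihg ihh
  | inv g _ ih => exact star_leftRegular g ▸ star_mem ih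

end Main

theorem mainTheorem3 {G : Type*} [Group G] (H : Subgroup G) :
    Set.centralizer (Set.centralizer
        (VonNeumannAlgebra.quasiNormalizers (groupVonNeumannAlgebra H)
          (groupVonNeumannAlgebra (⊤ : Subgroup G)))) =
      (groupVonNeumannAlgebra H.quasiNormalizerSubgroup : Set (EllTwo G →L[ℂ] EllTwo G)) ∧
    VonNeumannAlgebra.oneSidedQuasiNormalizerAlgebra (groupVonNeumannAlgebra H)
        (groupVonNeumannAlgebra (⊤ : Subgroup G)) =
      groupVonNeumannAlgebra H.oneSidedQuasiNormalizerSubgroup := by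

  refine ⟨Set.Subset.antisymm ?_ ?_, le_antisymm ?_ ?_⟩
  · rw [← VonNeumannAlgebra.centralizer_centralizer
      (groupVonNeumannAlgebra H.quasiNormalizerSubgroup)]
    exact Set.centralizer_subset (Set.centralizer_subset (quasiNormalizers_subset H))
  -- The generators λ_k, k ∈ H₁, are closed under adjoints, so L(H₁) is their plain double
  -- commutant.
  · rw [coe_groupVonNeumannAlgebra]
    refine Set.centralizer_subset (Set.centralizer_subset ?_)
    rintro _ ⟨g, hg, rfl⟩
    exact leftRegular_mem_quasiNormalizers hg
  · exact VonNeumannAlgebra.generatedBy_le_iff.2 (oneSidedQuasiNormalizers_subset H)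
  · exact groupVonNeumannAlgebra_closure_le fun g hg =>
      VonNeumannAlgebra.subset_generatedBy _ (leftRegular_mem_oneSidedQuasiNormalizers hg)
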